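/- Let $0\le k\le n$ and let $X$ be the set of words of length $n$ in the alphabet $\{1,2\}$ in which the letter $1$ occurs exactly $k$ times (equivalently, the $k$-subsets of $\{1,\dots,n\}$). Let $\mathcal F$ be the space of complex functions on $X$, with the inner product for which the delta functions are orthonormal and with the action $\sigma f=f\circ\sigma^{-1}$ of $S_n$, which permutes the places of the words. For $0\le j\le n$ let $S_j\subseteq S_n$ be the subgroup fixing $j+1,\dots,n$, and for an (isomorphism class of an) irreducible complex representation $\lambda$ of $S_j$ let $\mathcal F_{j,\lambda}$ be the $\lambda$-isotypic component of $\mathcal F$ as an $S_j$-module. For $0\le i\le n$ let $X_i$ be the set of words $w=c_{i+1}\cdots c_n$ in $\{1,2\}$ with at most $k$ letters $1$, and let $\mathcal F^w$ be the span of the delta functions at the words of $X$ that end in $w$. For $w\in X_i$ and a chain $T=(\lambda_1\nearrow\cdots\nearrow\lambda_i)$, where $\lambda_j\in\mathrm{Irr}(S_j)$ and $\lambda_j$ occurs in the restriction of $\lambda_{j+1}$ to $S_j$, put $$\mathcal F^w_T=\mathcal F_{1,\lambda_1}\cap\cdots\cap\mathcal F_{i,\lambda_i}\cap\mathcal F^w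 .$$ An $i$-th intermediate basis $B_i$ is an orthonormal basis of $\mathcal F$ each of whose elements lies in some $\mathcal F^w_T$ with $w\in X_i$ and $T$ a chain of length $i$; such a pair $(T,w)$ is called a label of the element. Let $1\le i\le n$, let $B_i$ and $B_{i-1}$ be intermediate bases, and let $b\in B_i$. Then at most two elements of $B_{i-1}$ are not orthogonal to $b$. Moreover, if $b$ has the label $(\lambda_1\nearrow\cdots\nearrow\lambda_i,\ c_{i+1}\cdots c_n)$, then every label of an element of $B_{i-1}$ not orthogonal to $b$ is of the form $(\lambda_1\nearrow\cdots\nearrow\lambda_{i-1},\ c_ic_{i+1}\cdots c_n)$ with $c_i\in\{1,2\}$, and two elements of $B_{i-1}$ not orthogonal to $b$ whose labels have the same letter $c_i$ are equal. -/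

import Mathlib

noncomputable section

namespace Johnson

/-- The alphabet `{1, 2}`. -/
inductive Letter
  | one
  | two
  deriving DecidableEq

instance : Fintype Letter := ⟨{Letter.one, Letter.two}, fun c => by cases c <;> simp⟩

/-- The set `X` of `k`-subsets of `{1, …, n}`, written as words of length `n` in which the
letter `1` occurs exactly `k` times (the place `j` carries the letter `1` iff `j` belongs to the
subset). The place `j ∈ {1, …, n}` is the element of `Fin n` of value `j - 1`. -/
abbrev X (n k : ℕ) : Type :=
  {x : Fin n → Letter // (Finset.univ.filter fun j => x j = Letter.one).card = k}

/-- The space of complex functions on `X`, with the inner product for which the delta functions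
are orthonormal. -/
abbrev F (n k : ℕ) : Type := EuclideanSpace ℂ (X n k)

/-- `σ⁻¹ x` for a permutation `σ` and a word `x`: the letter of `x` at the place `σ j` is moved
to the place `j`. -/
def permInv {n k : ℕ} (σ : Equiv.Perm (Fin n)) (x : X n k) : X n k :=
  ⟨fun j => x.1 (σ j), (Finset.card_equiv σ (by simp)).trans x.2⟩

/-- The action of `S_n` on functions, `(σ f)(x) = f (σ⁻¹ x)`. -/
def rep (n k : ℕ) : Representation ℂ (Equiv.Perm (Fin n)) (F n k) where
  toFun σ :=
    { toFun := fun f => WithLp.toLp 2 fun x => f (permInv σ x)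
      map_add' := fun _ _ => rfl
      map_smul' := fun _ _ => rfl }
  map_one' := rfl
  map_mul' _ _ := rfl

/-- The subgroup `S_i` of `S_n` of the permutations fixing the places `i + 1, …, n`. -/
def symSub (n i : ℕ) : Subgroup (Equiv.Perm (Fin n)) :=
  fixingSubgroup (Equiv.Perm (Fin n)) {j : Fin n | i ≤ (j : ℕ)}

theorem symSub_mono {n i j : ℕ} (h : i ≤ j) : symSub n i ≤ symSub n j :=
  fixingSubgroup_antitone _ _ fun _ hx => le_trans h hx

/-- The simple submodules of the regular representation of `G`, up to isomorphism. -/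
def irrSetoid (G : Type) [Group G] :
    Setoid {V : Submodule (MonoidAlgebra ℂ G) (MonoidAlgebra ℂ G) //
      IsSimpleModule (MonoidAlgebra ℂ G) V} where
  r V W := Nonempty (V.1 ≃ₗ[MonoidAlgebra ℂ G] W.1)
  iseqv :=
    { refl := fun _ => ⟨LinearEquiv.refl _ _⟩
      symm := fun ⟨e⟩ => ⟨e.symm⟩
      trans := fun ⟨e⟩ ⟨e'⟩ => ⟨e.trans e'⟩ }

/-- Equivalence classes of irreducible complex representations of a finite group `G`. Each class
has representatives among the simple submodules of the regular representation. -/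
def Irr (G : Type) [Group G] : Type := Quotient (irrSetoid G)

/-- The branching relation `μ ↗ lam` for `μ ∈ Irr(S_i)` and `lam ∈ Irr(S_{i+1})`: the
representation `μ` occurs in the restriction of `lam` to `S_i`, i.e. there is a nonzero
`S_i`-equivariant linear map `V_μ → V_lam`. -/
def Branches {n i : ℕ} (μ : Irr (symSub n i)) (lam : Irr (symSub n (i + 1))) : Prop :=
  ∃ V W, Quotient.mk (irrSetoid (symSub n i)) V = μ ∧
    Quotient.mk (irrSetoid (symSub n (i + 1))) W = lam ∧
    ∃ f : V.1 →ₗ[ℂ] W.1, f ≠ 0 ∧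
      ∀ (g : symSub n i) (v : V.1),
        f (MonoidAlgebra.of ℂ _ g • v) =
          MonoidAlgebra.of ℂ _ (Subgroup.inclusion (symSub_mono (Nat.le_succ i)) g) • f v

/-- A chain `λ_1 ↗ λ_2 ↗ ⋯ ↗ λ_i` with `λ_j ∈ Irr(S_j)`; `irr j` is `λ_{j+1}`. -/
@[ext]
structure Chain (n i : ℕ) where
  irr : ∀ j : Fin i, Irr (symSub n ((j : ℕ) + 1))
  branches : ∀ (j : ℕ) (h : j + 1 < i),
    Branches (irr ⟨j, Nat.lt_of_succ_lt h⟩) (irr ⟨j + 1, h⟩)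

/-- The chain `λ_1 ↗ ⋯ ↗ λ_i` obtained from `λ_1 ↗ ⋯ ↗ λ_i ↗ λ_{i+1}`. -/
def Chain.init {n i : ℕ} (T : Chain n (i + 1)) : Chain n i where
  irr j := T.irr j.castSucc
  branches j h := T.branches j (Nat.lt_succ_of_lt h)

/-- The function space, as a representation of `S_i`. -/
def repSub (n k i : ℕ) : Representation ℂ (symSub n i) (F n k) :=
  (rep n k).comp (symSub n i).subtype

/-- The isotypic component `F_{i,λ}` of the function space, seen as an `S_i`-module. -/
def isotypic (n k i : ℕ) (lam : Irr (symSub n i)) : Submodule ℂ (F n k) :=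
  Quotient.lift
    (fun V => ((isotypicComponent (MonoidAlgebra ℂ (symSub n i)) (repSub n k i).asModule
      V.1).restrictScalars ℂ).map ((repSub n k i).asModuleEquiv : _ →ₗ[ℂ] F n k))
    (fun _ _ h => by obtain ⟨e⟩ := h; rw [e.isotypicComponent_eq]) lam

/-- The set `X_i` of words `c_{i+1} ⋯ c_n` in which the letter `1` occurs at most `k` times. -/
abbrev Word (n k i : ℕ) : Type :=
  {w : {j : Fin n // i ≤ (j : ℕ)} → Letter //
    (Finset.univ.filter fun j => w j = Letter.one).card ≤ k}

/-- The subspace `F^w` spanned by the delta functions at the words `x ∈ X` that end in `w`. -/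
def wordSpace {n k i : ℕ} (w : Word n k i) : Submodule ℂ (F n k) :=
  Submodule.span ℂ {f | ∃ x : X n k, (∀ j, x.1 j.1 = w.1 j) ∧ f = EuclideanSpace.single x 1}

/-- The Gelfand–Tsetlin subspace `F^w_T = F_{1,λ_1} ∩ ⋯ ∩ F_{i,λ_i} ∩ F^w`
for the chain `T = (λ_1 ↗ ⋯ ↗ λ_i)`. -/
def gtSpace {n k i : ℕ} (w : Word n k i) (T : Chain n i) : Submodule ℂ (F n k) :=
  (⨅ j : Fin i, isotypic n k ((j : ℕ) + 1) (T.irr j)) ⊓ wordSpace w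

/-- `B` is an `i`-th intermediate basis: an orthonormal basis of the function space each of whose
elements lies in one of the Gelfand–Tsetlin subspaces `F^w_T`, `w ∈ X_i`. (That the nonzero
subspaces among these are lines, so that `B` is unique up to scalars, is not part of
the definition.) -/
structure IsIntermediateBasis (n k i : ℕ) (B : Set (F n k)) : Prop where
  orthonormal : Orthonormal ℂ (Subtype.val : B → F n k)
  span_eq_top : Submodule.span ℂ B = ⊤
  mem_gtSpace : ∀ b ∈ B, ∃ (w : Word n k i) (T : Chain n i), b ∈ gtSpace w T

end Johnson

end

noncomputable section

namespace Johnson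

/-! Two observations restrict the labels of an element of the lower basis that is not orthogonal to
`b`. Distinct isotypic components of a unitary representation are orthogonal, so the chains agree as
far as both go; and two functions with nonzero inner product are both nonzero at some word, so the
suffixes agree as well. Only one letter remains free. It then suffices that every `gtSpace w T` is
at most a line (`eq_smul_of_mem_gtSpace`), for an orthonormal set has at most one element on a line.

The sum of the transpositions in `S_j` is central, so by Schur's lemma it acts on an isotypic
component by a scalar. Elements of `gtSpace w T` are thus joint eigenfunctions of these sums, and
`IsJointEigen.eq_smul` bounds the joint eigenspaces by induction on `i`. Fixing the letter at the
last free place `p` embeds such a space in a sum of two lines. If it were a plane, it would contain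
nonzero `f` and `g` living on the words with letter 1, respectively 2, at `p`.

This is impossible. The Jucys–Murphy sum of the `(a p)`, `a < p`, has the same eigenvalue on `f` and
`g`. It counts the letters 1 left of `p` in words of `f` and the letters 2 left of `p` in words of
`g`, while words of `g` have one letter 1 more there than words of `f`. So words of `g` have fewer
2s than 1s left of `p`. The eigenvalue equation also makes the operator changing a 2 to a 1
annihilate `g`, and the `sl₂` commutation relation then forces `g = 0`. -/

/-! ### Joint eigenfunctions on words -/

/-- The number of places among the first `i` at which the word `x` has the letter `l`. -/
def letterCount {n : ℕ} (i : ℕ) (l : Letter) (x : Fin n → Letter) : ℕ :=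
  (Finset.univ.filter fun a : Fin n => (a : ℕ) < i ∧ x a = l).card

/-- The sum of the transpositions `(a b)`, over all ordered pairs of places among the first `j`
(with `(a a) = 1`), acting on functions on words. -/
def swapSum {n : ℕ} (j : ℕ) (f : (Fin n → Letter) → ℂ) (x : Fin n → Letter) : ℂ :=
  ∑ a ∈ Finset.univ.filter (fun a : Fin n => (a : ℕ) < j),
    ∑ b ∈ Finset.univ.filter (fun b : Fin n => (b : ℕ) < j), f (x ∘ Equiv.swap a b)

/-- The operator that sums `f` over the words obtained by changing one letter `l`, among the
first `i` places, to `l'`. -/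
def changeSum {n : ℕ} (i : ℕ) (l l' : Letter) (f : (Fin n → Letter) → ℂ) (x : Fin n → Letter) : ℂ :=
  ∑ a ∈ Finset.univ.filter (fun a : Fin n => (a : ℕ) < i ∧ x a = l), f (Function.update x a l')

/-- The functions supported on the words with `k` letters `1` that agree with `w` from the place
`i` on, and that are eigenfunctions of the operators `swapSum j`, `j ≤ i`, of eigenvalue `c j`. -/
structure IsJointEigen {n : ℕ} (k : ℕ) (c : ℕ → ℂ) (i : ℕ) (w : Fin n → Letter)
    (f : (Fin n → Letter) → ℂ) : Prop where
  count : ∀ x, f x ≠ 0 → letterCount n Letter.one x = k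
  suffix : ∀ x, f x ≠ 0 → ∀ j : Fin n, i ≤ (j : ℕ) → x j = w j
  eigen : ∀ j ≤ i, ∀ x, swapSum j f x = c j * f x

/-- The restriction of `f` to the words with letter `l` at the place `p`. -/
def letterPart {n : ℕ} (p : Fin n) (l : Letter) (f : (Fin n → Letter) → ℂ)
    (x : Fin n → Letter) : ℂ :=
  if x p = l then f x else 0

theorem swapSum_sub_smul {n : ℕ} (j : ℕ) (t : ℂ) (f g : (Fin n → Letter) → ℂ)
    (x : Fin n → Letter) :
    swapSum j (g - t • f) x = swapSum j g x - t * swapSum j f x := by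
  simp [swapSum, Finset.sum_sub_distrib, Finset.mul_sum]

theorem IsJointEigen.sub_smul {n k i : ℕ} {c : ℕ → ℂ} {w : Fin n → Letter}
    {f g : (Fin n → Letter) → ℂ} (hg : IsJointEigen k c i w g) (hf : IsJointEigen k c i w f)
    (t : ℂ) : IsJointEigen k c i w (g - t • f) := by
  have key : ∀ x, (g - t • f) x ≠ 0 → g x ≠ 0 ∨ f x ≠ 0 := by
    intro x hx
    by_contra! h
    exact hx (by simp [h.1, h.2])
  refine ⟨fun x hx => ?_, fun x hx => ?_, fun j hj x => ?_⟩
  · rcases key x hx with h | h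
    exacts [hg.count x h, hf.count x h]
  · rcases key x hx with h | h
    exacts [hg.suffix x h, hf.suffix x h]
  · rw [swapSum_sub_smul, hg.eigen j hj, hf.eigen j hj]
    simp only [Pi.sub_apply, Pi.smul_apply, smul_eq_mul]
    ring

/-- Permutations of the places before `j ≤ p` leave the letter at `p` alone. -/
theorem swapSum_letterPart {n j : ℕ} (p : Fin n) (hj : j ≤ (p : ℕ)) (l : Letter)
    (f : (Fin n → Letter) → ℂ) (x : Fin n → Letter) :
    swapSum j (letterPart p l f) x = if x p = l then swapSum j f x else 0 := by
  have h : ∀ a ∈ Finset.univ.filter (fun a : Fin n => (a : ℕ) < j),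
      ∀ b ∈ Finset.univ.filter (fun b : Fin n => (b : ℕ) < j),
      letterPart p l f (x ∘ Equiv.swap a b) = if x p = l then f (x ∘ Equiv.swap a b) else 0 := by
    intro a ha b hb
    simp only [Finset.mem_filter, Finset.mem_univ, true_and] at ha hb
    have : Equiv.swap a b p = p := Equiv.swap_apply_of_ne_of_ne
      (by rintro rfl; omega) (by rintro rfl; omega)
    simp [letterPart, this]
  unfold swapSum
  rw [Finset.sum_congr rfl fun a ha => Finset.sum_congr rfl (h a ha)]
  split_ifs <;> simp

theorem IsJointEigen.letterPart {n k : ℕ} {c : ℕ → ℂ} {w : Fin n → Letter} {p : Fin n}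
    {f : (Fin n → Letter) → ℂ} (hf : IsJointEigen k c (p + 1) w f) (l : Letter) :
    IsJointEigen k c p (Function.update w p l) (letterPart p l f) := by
  have key : ∀ x, Johnson.letterPart p l f x ≠ 0 → x p = l ∧ f x ≠ 0 := by
    intro x hx
    simpa [Johnson.letterPart] using hx
  refine ⟨fun x hx => hf.count x (key x hx).2, fun x hx j hj => ?_, fun j hj x => ?_⟩
  · by_cases hjp : j = p
    · subst hjp; simp [(key x hx).1]
    · rw [Function.update_of_ne hjp]
      exact hf.suffix x (key x hx).2 j (by have : (j : ℕ) ≠ p := fun h => hjp (Fin.ext h); omega)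
  · rw [swapSum_letterPart p hj, hf.eigen j (by omega)]
    simp [Johnson.letterPart]

/-! ### The Jucys–Murphy sum at the last place -/

/-- The new ordered pairs are `(a, p)` and `(p, a)`, whence the factor 2, and `(p, p)`, which
contributes the identity. -/
theorem swapSum_succ {n : ℕ} (p : Fin n) (f : (Fin n → Letter) → ℂ) (x : Fin n → Letter) :
    swapSum (p + 1) f x = swapSum p f x +
      2 * (∑ a ∈ Finset.univ.filter (fun a : Fin n => (a : ℕ) < p), f (x ∘ Equiv.swap a p)) + f x := by
  have h : (Finset.univ.filter fun a : Fin n => (a : ℕ) < p + 1) =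
      insert p (Finset.univ.filter fun a : Fin n => (a : ℕ) < p) := by
    ext a
    simp only [Finset.mem_filter, Finset.mem_univ, true_and, Finset.mem_insert, Fin.ext_iff]
    omega
  unfold swapSum
  rw [h, Finset.sum_insert (by simp), Finset.sum_insert (by simp)]
  simp_rw [Finset.sum_insert (show p ∉ Finset.univ.filter fun a : Fin n => (a : ℕ) < p by simp)]
  rw [Finset.sum_add_distrib]
  simp only [Equiv.swap_self, Equiv.coe_refl, Function.comp_id, Equiv.swap_comm p]
  ring

/-- The sum of the transpositions `(a p)`, `a < p`, on a joint eigenfunction. -/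
theorem IsJointEigen.sum_swap_last {n k : ℕ} {c : ℕ → ℂ} {w : Fin n → Letter} {p : Fin n}
    {f : (Fin n → Letter) → ℂ} (hf : IsJointEigen k c (p + 1) w f) (x : Fin n → Letter) :
    ∑ a ∈ Finset.univ.filter (fun a : Fin n => (a : ℕ) < p), f (x ∘ Equiv.swap a p) =
      (c (p + 1) - c p - 1) / 2 * f x := by
  have h := swapSum_succ p f x
  rw [hf.eigen _ le_rfl, hf.eigen p (Nat.le_succ _)] at h
  linear_combination (-1 / 2) * h

theorem comp_swap_eq_self {n : ℕ} {x : Fin n → Letter} {a p : Fin n} (h : x a = x p) :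
    x ∘ Equiv.swap a p = x := by
  ext j
  simp only [Function.comp_apply, Equiv.swap_apply_def]
  split_ifs with h1 h2
  · rw [h1, h]
  · rw [h2, h]
  · rfl

/-- If `f` lives on the words with letter `l` at the place `p`, the eigenvalue of the sum of the
transpositions `(a p)` counts the letters `l` to the left of `p`. -/
theorem letterCount_eq_of_pure {n : ℕ} {p : Fin n} {l : Letter} {d : ℂ}
    {f : (Fin n → Letter) → ℂ}
    (hd : ∀ x, ∑ a ∈ Finset.univ.filter (fun a : Fin n => (a : ℕ) < p), f (x ∘ Equiv.swap a p) = d * f x)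
    (hl : ∀ x, f x ≠ 0 → x p = l) {x : Fin n → Letter} (hx : f x ≠ 0) :
    (letterCount p l x : ℂ) = d := by
  have h := hd x
  have hp := hl x hx
  -- The transposition brings the letter `x a` to `p`: if it is `l` the word does not change,
  -- otherwise `f` vanishes there.
  have h1 : ∀ a ∈ Finset.univ.filter (fun a : Fin n => (a : ℕ) < p),
      f (x ∘ Equiv.swap a p) = if x a = l then f x else 0 := by
    intro a _
    split_ifs with ha
    · rw [comp_swap_eq_self (ha.trans hp.symm)]
    · by_contra hne
      exact ha (by simpa using hl _ hne)
  rw [Finset.sum_congr rfl h1, ← Finset.sum_filter, Finset.filter_filter, Finset.sum_const,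
    nsmul_eq_mul] at h
  exact mul_right_cancel₀ hx h

/-- If `f` lives on the words with letter `2` at the place `p`, and is an eigenfunction of the sum
of the transpositions `(a p)`, it is annihilated by changing a letter `2` to `1`. -/
theorem changeSum_eq_zero_of_pure {n : ℕ} {p : Fin n} {d : ℂ}
    {f : (Fin n → Letter) → ℂ}
    (hd : ∀ x, ∑ a ∈ Finset.univ.filter (fun a : Fin n => (a : ℕ) < p), f (x ∘ Equiv.swap a p) = d * f x)
    (hl : ∀ x, f x ≠ 0 → x p = Letter.two) (y : Fin n → Letter) :
    changeSum p Letter.two Letter.one f y = 0 := by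
  by_cases hy : y p = Letter.two
  -- At this word `f` vanishes, so the eigenvalue drops out; swapping the new 1 at `p` with a 2 at
  -- `a` amounts to changing that 2 of `y` to 1.
  · have h := hd (Function.update y p Letter.one)
    have h0 : f (Function.update y p Letter.one) = 0 := by
      by_contra hne
      simpa using hl _ hne
    rw [h0, mul_zero] at h
    rw [← h]
    unfold changeSum
    rw [← Finset.filter_filter, Finset.sum_filter]
    refine Finset.sum_congr rfl fun a ha => ?_
    have hap : a ≠ p := by rintro rfl; simp at ha
    split_ifs with hya
    · congr 1
      ext j
      simp only [Function.comp_apply, Equiv.swap_apply_def, Function.update_apply]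
      split_ifs <;> simp_all
    · symm
      by_contra hne
      have := hl _ hne
      simp [Function.update_of_ne hap] at this
      exact hya this
  · refine Finset.sum_eq_zero fun a ha => ?_
    simp only [Finset.mem_filter, Finset.mem_univ, true_and] at ha
    by_contra hne
    have := hl _ hne
    rw [Function.update_of_ne (by rintro rfl; omega)] at this
    exact hy this

/-! ### The `sl₂` relation for changing letters -/

/-- Changing back the letter just changed restores `y`; changing another one exchanges two distinct
letters of `y`. -/
theorem changeSum_changeSum {n i : ℕ} {l l' : Letter} (hll : l ≠ l')
    (f : (Fin n → Letter) → ℂ) (y : Fin n → Letter) :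
    changeSum i l l' (changeSum i l' l f) y = letterCount i l y * f y +
      ∑ a ∈ Finset.univ.filter (fun a : Fin n => (a : ℕ) < i ∧ y a = l),
        ∑ b ∈ Finset.univ.filter (fun b : Fin n => (b : ℕ) < i ∧ y b = l'),
        f (y ∘ Equiv.swap a b) := by
  unfold changeSum
  have key : ∀ a ∈ Finset.univ.filter (fun a : Fin n => (a : ℕ) < i ∧ y a = l),
      ∑ b ∈ Finset.univ.filter (fun b : Fin n => (b : ℕ) < i ∧ Function.update y a l' b = l'),
        f (Function.update (Function.update y a l') b l) =
      f y +
        ∑ b ∈ Finset.univ.filter (fun b : Fin n => (b : ℕ) < i ∧ y b = l'), f (y ∘ Equiv.swap a b) := by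
    intro a ha
    simp only [Finset.mem_filter, Finset.mem_univ, true_and] at ha
    have h : (Finset.univ.filter fun b : Fin n => (b : ℕ) < i ∧ Function.update y a l' b = l') =
        insert a (Finset.univ.filter fun b : Fin n => (b : ℕ) < i ∧ y b = l') := by
      ext b
      by_cases hb : b = a
      · subst hb; simp [ha.1]
      · simp [hb]
    rw [h, Finset.sum_insert (by simp [ha.2, hll])]
    congr 1
    · congr 1
      rw [Function.update_idem, ← ha.2, Function.update_eq_self]
    · refine Finset.sum_congr rfl fun b hb => ?_
      simp only [Finset.mem_filter, Finset.mem_univ, true_and] at hb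
      have hab : a ≠ b := by rintro rfl; exact hll (ha.2.symm.trans hb.2)
      congr 1
      ext j
      simp only [Function.comp_apply, Equiv.swap_apply_def, Function.update_apply]
      split_ifs <;> simp_all
  rw [Finset.sum_congr rfl key, Finset.sum_add_distrib, Finset.sum_const, nsmul_eq_mul]
  rfl

/-- The exchange terms are symmetric in the two letters and cancel. -/
theorem changeSum_commutator {n i : ℕ} {l l' : Letter} (hll : l ≠ l')
    (f : (Fin n → Letter) → ℂ) (y : Fin n → Letter) :
    changeSum i l l' (changeSum i l' l f) y - changeSum i l' l (changeSum i l l' f) y =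
      ((letterCount i l y : ℂ) - letterCount i l' y) * f y := by
  rw [changeSum_changeSum hll, changeSum_changeSum hll.symm]
  rw [Finset.sum_comm]
  simp_rw [Equiv.swap_comm]
  ring

/-- Changing letters `l` to `l'` is adjoint to changing letters `l'` to `l`. -/
theorem sum_changeSum_mul {n i : ℕ} (l l' : Letter) (f g : (Fin n → Letter) → ℂ) :
    ∑ y, changeSum i l l' f y * g y = ∑ y, f y * changeSum i l' l g y := by
  unfold changeSum
  simp_rw [Finset.sum_mul, Finset.mul_sum]
  rw [Finset.sum_sigma', Finset.sum_sigma']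
  refine Finset.sum_bij' (fun q _ => ⟨Function.update q.1 q.2 l', q.2⟩)
    (fun q _ => ⟨Function.update q.1 q.2 l, q.2⟩) ?_ ?_ ?_ ?_ ?_
  all_goals
    rintro ⟨y, a⟩ h
    simp only [Finset.mem_sigma, Finset.mem_filter, Finset.mem_univ, true_and] at h
    simp [← h.2, h.1]

theorem changeSum_conj {n i : ℕ} (l l' : Letter) (f : (Fin n → Letter) → ℂ)
    (y : Fin n → Letter) :
    changeSum i l l' (fun x => starRingEnd ℂ (f x)) y = starRingEnd ℂ (changeSum i l l' f y) := by
  simp [changeSum]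

/-- A function annihilated by changing `2` to `1`, all of whose words have fewer letters `2` than
letters `1` in the first `i` places, vanishes. -/
theorem eq_zero_of_changeSum_eq_zero {n i : ℕ} {f : (Fin n → Letter) → ℂ}
    (h0 : ∀ y, changeSum i Letter.two Letter.one f y = 0)
    (hc : ∀ y, f y ≠ 0 → letterCount i Letter.two y < letterCount i Letter.one y) : f = 0 := by
  have h1 : ∀ y, changeSum i Letter.two Letter.one (changeSum i Letter.one Letter.two f) y =
      ((letterCount i Letter.two y : ℂ) - letterCount i Letter.one y) * f y := by
    intro y
    rw [← changeSum_commutator (by decide), sub_eq_self.mpr]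
    exact Finset.sum_eq_zero fun a _ => h0 _
  -- By adjointness the left side, a squared norm, pairs `f` with its image under the composite in
  -- `h1`; the right side is negative unless `f = 0`.
  have h2 : ∑ y, Complex.normSq (changeSum i Letter.one Letter.two f y) =
      ∑ y, ((letterCount i Letter.two y : ℝ) - letterCount i Letter.one y) *
        Complex.normSq (f y) := by
    have h := sum_changeSum_mul (i := i) Letter.two Letter.one
      (changeSum i Letter.one Letter.two f) (fun x => starRingEnd ℂ (f x))
    simp_rw [h1, changeSum_conj, mul_assoc, Complex.mul_conj] at h
    exact_mod_cast h.symm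
  have h3 : ∀ y, ((letterCount i Letter.two y : ℝ) - letterCount i Letter.one y) *
      Complex.normSq (f y) ≤ 0 := by
    intro y
    by_cases hy : f y = 0
    · simp [hy]
    · have : (letterCount i Letter.two y : ℝ) < letterCount i Letter.one y := by
        exact_mod_cast hc y hy
      exact mul_nonpos_of_nonpos_of_nonneg (by linarith) (Complex.normSq_nonneg _)
  have h4 : ∑ y, ((letterCount i Letter.two y : ℝ) - letterCount i Letter.one y) *
      Complex.normSq (f y) = 0 :=
    le_antisymm (Finset.sum_nonpos fun y _ => h3 y)
      (h2 ▸ Finset.sum_nonneg fun y _ => Complex.normSq_nonneg _)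
  funext y
  by_contra hy
  have h5 := (Finset.sum_eq_zero_iff_of_nonpos fun y _ => h3 y).1 h4 y (Finset.mem_univ y)
  rcases mul_eq_zero.1 h5 with h | h
  · have : (letterCount i Letter.two y : ℝ) < letterCount i Letter.one y := by
      exact_mod_cast hc y hy
    linarith
  · exact hy (Complex.normSq_eq_zero.1 h)

/-! ### Joint eigenspaces are at most lines -/

/-- The total number of 1s and the letters after `p` agree, so the 1 missing at `p` in `y` must
stand to the left. -/
theorem letterCount_one_eq {n : ℕ} (p : Fin n) {x y : Fin n → Letter}
    (hx : x p = Letter.one) (hy : y p = Letter.two)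
    (hxy : ∀ j : Fin n, (p : ℕ) + 1 ≤ j → x j = y j)
    (h : letterCount n Letter.one x = letterCount n Letter.one y) :
    letterCount p Letter.one y = letterCount p Letter.one x + 1 := by
  have hs : ∀ z : Fin n → Letter, letterCount n Letter.one z = letterCount p Letter.one z +
      (if z p = Letter.one then 1 else 0) +
      (Finset.univ.filter fun a : Fin n => (p : ℕ) + 1 ≤ a ∧ z a = Letter.one).card := by
    intro z
    unfold letterCount
    have : (if z p = Letter.one then 1 else 0) =
        (Finset.univ.filter fun a : Fin n => a = p ∧ z a = Letter.one).card := by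
      rw [← Finset.filter_filter, Finset.filter_eq' Finset.univ p]
      simp only [Finset.mem_univ, if_true, Finset.filter_singleton]
      split_ifs <;> simp
    rw [this, ← Finset.card_union_of_disjoint, ← Finset.card_union_of_disjoint]
    · congr 1
      ext a
      simp only [Finset.mem_filter, Finset.mem_univ, true_and, Finset.mem_union, Fin.ext_iff]
      have := a.2
      grind
    · rw [Finset.disjoint_left]
      intro a
      simp only [Finset.mem_filter, Finset.mem_univ, true_and, Finset.mem_union, Fin.ext_iff]
      omega
    · rw [Finset.disjoint_left]
      intro a
      simp only [Finset.mem_filter, Finset.mem_univ, true_and, Fin.ext_iff]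
      omega
  have ht : (Finset.univ.filter fun a : Fin n => (p : ℕ) + 1 ≤ a ∧ x a = Letter.one) =
      (Finset.univ.filter fun a : Fin n => (p : ℕ) + 1 ≤ a ∧ y a = Letter.one) := by
    ext a
    simp only [Finset.mem_filter, Finset.mem_univ, true_and]
    exact and_congr_right fun ha => by rw [hxy a ha]
  rw [hs x, hs y, ht, hx, hy] at h
  simp at h
  omega

/-- Two joint eigenfunctions of the same eigenvalues, living on the words with letter `1`,
respectively `2`, at the place `p`, are not both nonzero. -/
theorem IsJointEigen.eq_zero_of_pure {n k : ℕ} {c : ℕ → ℂ} {w : Fin n → Letter} {p : Fin n}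
    {f g : (Fin n → Letter) → ℂ} (hf : IsJointEigen k c (p + 1) w f)
    (hg : IsJointEigen k c (p + 1) w g) (hf1 : ∀ x, f x ≠ 0 → x p = Letter.one)
    (hg2 : ∀ x, g x ≠ 0 → x p = Letter.two) (hf0 : f ≠ 0) : g = 0 := by
  obtain ⟨x, hx⟩ := Function.ne_iff.1 hf0
  refine eq_zero_of_changeSum_eq_zero (changeSum_eq_zero_of_pure hg.sum_swap_last hg2)
    fun y hy => ?_
  have e1 := letterCount_eq_of_pure hf.sum_swap_last hf1 hx
  have e2 := letterCount_eq_of_pure hg.sum_swap_last hg2 hy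
  have e3 := letterCount_one_eq p (hf1 x hx) (hg2 y hy)
    (fun j hj => (hf.suffix x hx j hj).trans (hg.suffix y hy j hj).symm)
    ((hf.count x hx).trans (hg.count y hy).symm)
  have e4 : letterCount p Letter.one x = letterCount p Letter.two y := by
    exact_mod_cast e1.trans e2.symm
  omega

theorem letterPart_add {n : ℕ} (p : Fin n) (f : (Fin n → Letter) → ℂ) :
    letterPart p Letter.one f + letterPart p Letter.two f = f := by
  funext x
  cases h : x p <;> simp [letterPart, h]

theorem letterPart_eq_zero {n : ℕ} {p : Fin n} {l : Letter} {f : (Fin n → Letter) → ℂ}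
    (h : letterPart p l f = 0) (x : Fin n → Letter) (hx : f x ≠ 0) : x p ≠ l := by
  intro hl
  have := congrFun h x
  simp [letterPart, hl, hx] at this

theorem letterPart_sub_smul {n : ℕ} (p : Fin n) (l : Letter) (t : ℂ)
    (f g : (Fin n → Letter) → ℂ) :
    letterPart p l (g - t • f) = letterPart p l g - t • letterPart p l f := by
  funext x
  by_cases h : x p = l <;> simp [letterPart, h]

theorem ne_one_iff {l : Letter} : l ≠ Letter.one ↔ l = Letter.two := by cases l <;> simp

theorem ne_two_iff {l : Letter} : l ≠ Letter.two ↔ l = Letter.one := by cases l <;> simp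

/-- The joint eigenspaces are at most one-dimensional. -/
theorem IsJointEigen.eq_smul {n k : ℕ} {c : ℕ → ℂ} {i : ℕ} (hi : i ≤ n) {w : Fin n → Letter}
    {f g : (Fin n → Letter) → ℂ} (hf : IsJointEigen k c i w f) (hg : IsJointEigen k c i w g)
    (hf0 : f ≠ 0) : ∃ t : ℂ, g = t • f := by
  induction i generalizing w f g with
  | zero =>
    have key : ∀ {h}, IsJointEigen k c 0 w h → ∀ x, h x ≠ 0 → x = w := fun hh x hx =>
      funext fun j => hh.suffix x hx j (Nat.zero_le _)
    obtain ⟨x, hx⟩ := Function.ne_iff.1 hf0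
    obtain rfl := key hf x hx
    have hx' : f x ≠ 0 := hx
    refine ⟨g x / f x, funext fun y => ?_⟩
    by_cases hy : y = x
    · subst hy; simp [hx']
    · have h1 : g y = 0 := by_contra fun h => hy (key hg y h)
      have h2 : f y = 0 := by_contra fun h => hy (key hf y h)
      simp [h1, h2]
  | succ i ih =>
    let p : Fin n := ⟨i, hi⟩
    have hstep : ∀ (l : Letter) {f g : (Fin n → Letter) → ℂ}, IsJointEigen k c (i + 1) w f →
        IsJointEigen k c (i + 1) w g → Johnson.letterPart p l f ≠ 0 →
        ∃ t : ℂ, Johnson.letterPart p l (g - t • f) = 0 := by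
      intro l f g hf hg h
      obtain ⟨t, ht⟩ := ih (by omega) (IsJointEigen.letterPart (p := p) hf l)
        (IsJointEigen.letterPart (p := p) hg l) h
      exact ⟨t, by rw [letterPart_sub_smul, ht, sub_self]⟩
    by_cases h1 : Johnson.letterPart p Letter.one f = 0
    · have h2 : Johnson.letterPart p Letter.two f ≠ 0 := by
        intro h2
        exact hf0 (by rw [← letterPart_add p f, h1, h2, add_zero])
      obtain ⟨t, ht⟩ := hstep Letter.two hf hg h2
      -- Here `f` is pure of letter 2 and `g - t • f` is pure of letter 1; if the latter were
      -- nonzero, `f` would vanish.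
      refine ⟨t, sub_eq_zero.1 (by_contra fun hne => hf0 ?_)⟩
      exact (hg.sub_smul hf t).eq_zero_of_pure (p := p) hf
        (fun x hx => ne_two_iff.1 (letterPart_eq_zero ht x hx))
        (fun x hx => ne_one_iff.1 (letterPart_eq_zero h1 x hx)) hne
    · obtain ⟨t, ht⟩ := hstep Letter.one hf hg h1
      refine ⟨t, sub_eq_zero.1 (by_contra fun hne => ?_)⟩
      have hh := hg.sub_smul hf t
      have h2 : Johnson.letterPart p Letter.two (g - t • f) ≠ 0 := by
        intro h2
        exact hne (by rw [← letterPart_add p (g - t • f), ht, h2, add_zero])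
      -- Now `g - t • f` is pure of letter 2. Subtracting a multiple of it from `f` leaves a
      -- function pure of letter 1, nonzero because its letter-1 part is that of `f`.
      obtain ⟨s, hs⟩ := hstep Letter.two hh hf h2
      refine hne ((hf.sub_smul hh s).eq_zero_of_pure (p := p) hh
        (fun x hx => ne_two_iff.1 (letterPart_eq_zero hs x hx))
        (fun x hx => ne_one_iff.1 (letterPart_eq_zero ht x hx)) fun h0 => h1 ?_)
      have := letterPart_sub_smul p Letter.one s (g - t • f) f
      rw [h0, ht, smul_zero, sub_zero] at this
      rw [← this]
      funext x
      simp [Johnson.letterPart]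

/-! ### Isotypic components: orthogonality and central scalars -/

/-- Orthogonal projection to a submodule of a unitary representation, as an equivariant map. -/
theorem exists_equivariant_projection {G E : Type*} [Group G] [NormedAddCommGroup E]
    [InnerProductSpace ℂ E] [FiniteDimensional ℂ E] (ρ : Representation ℂ G E)
    (hρ : ∀ g u v, inner ℂ (ρ g u) (ρ g v) = inner ℂ u v)
    (N : Submodule (MonoidAlgebra ℂ G) ρ.asModule) :
    ∃ P : ρ.asModule →ₗ[MonoidAlgebra ℂ G] N, ∀ v, ∀ u ∈ N,
      inner ℂ (ρ.asModuleEquiv v - ρ.asModuleEquiv (P v : ρ.asModule)) (ρ.asModuleEquiv u) = 0 := by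
  let K : Submodule ℂ E := (N.restrictScalars ℂ).map (ρ.asModuleEquiv : _ →ₗ[ℂ] E)
  have hK : ∀ u, ρ.asModuleEquiv u ∈ K ↔ u ∈ N := by
    intro u
    simp [K]
  have hKg : ∀ (g : G) (u : E), u ∈ K → ρ g u ∈ K := by
    intro g u hu
    obtain ⟨u, rfl⟩ := ρ.asModuleEquiv.surjective u
    have : ρ g (ρ.asModuleEquiv u) = ρ.asModuleEquiv (MonoidAlgebra.of ℂ G g • u) := by
      rw [Representation.asModuleEquiv_map_smul, Representation.asAlgebraHom_of]
    rw [this, hK]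
    exact N.smul_mem _ ((hK u).1 hu)
  have hcomm : ∀ (g : G) (u : E), K.starProjection (ρ g u) = ρ g (K.starProjection u) := by
    intro g u
    refine Submodule.eq_starProjection_of_mem_of_inner_eq_zero
      (hKg g _ (Submodule.starProjection_apply_mem K u)) fun v hv => ?_
    have hv' : v = ρ g (ρ g⁻¹ v) := by simp
    rw [hv', ← map_sub, hρ]
    exact Submodule.starProjection_inner_eq_zero _ _ (hKg _ _ hv)
  let P₀ : ρ.asModule →ₗ[ℂ] ρ.asModule :=
    (ρ.asModuleEquiv.symm : E →ₗ[ℂ] ρ.asModule) ∘ₗ (K.starProjection : E →ₗ[ℂ] E) ∘ₗ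
      (ρ.asModuleEquiv : _ →ₗ[ℂ] E)
  let P₁ : ρ.asModule →ₗ[MonoidAlgebra ℂ G] ρ.asModule :=
    MonoidAlgebra.equivariantOfLinearOfComm P₀ fun g v => by
      apply ρ.asModuleEquiv.injective
      rw [Representation.asModuleEquiv_map_smul, Representation.asAlgebraHom_single_one]
      change K.starProjection (ρ.asModuleEquiv (MonoidAlgebra.single g 1 • v)) =
        ρ g (K.starProjection (ρ.asModuleEquiv v))
      rw [Representation.asModuleEquiv_map_smul, Representation.asAlgebraHom_single_one, hcomm]
  have hP : ∀ v, ρ.asModuleEquiv (P₁ v) = K.starProjection (ρ.asModuleEquiv v) := by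
    intro v
    simp [P₁, P₀]
  refine ⟨P₁.codRestrict N fun v => ?_, fun v u hu => ?_⟩
  · rw [← hK, hP]
    exact Submodule.starProjection_apply_mem K _
  · rw [LinearMap.codRestrict_apply, hP]
    exact Submodule.starProjection_inner_eq_zero _ _ ((hK u).2 hu)

/-- By Schur's lemma the equivariant orthogonal projection to `N` vanishes on a simple submodule not
isomorphic to `N`. -/
theorem inner_eq_zero_of_simple {G E : Type*} [Group G] [NormedAddCommGroup E]
    [InnerProductSpace ℂ E] [FiniteDimensional ℂ E] (ρ : Representation ℂ G E)
    (hρ : ∀ g u v, inner ℂ (ρ g u) (ρ g v) = inner ℂ u v)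
    (N N' : Submodule (MonoidAlgebra ℂ G) ρ.asModule) [IsSimpleModule (MonoidAlgebra ℂ G) N]
    [IsSimpleModule (MonoidAlgebra ℂ G) N'] (h : IsEmpty (N' ≃ₗ[MonoidAlgebra ℂ G] N))
    {v u : ρ.asModule} (hv : v ∈ N') (hu : u ∈ N) :
    inner ℂ (ρ.asModuleEquiv v) (ρ.asModuleEquiv u) = 0 := by
  obtain ⟨P, hP⟩ := exists_equivariant_projection ρ hρ N
  rcases (P ∘ₗ N'.subtype).bijective_or_eq_zero with hb | h0
  · exact (h.false (LinearEquiv.ofBijective _ hb)).elim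
  · have hPv : P v = 0 := congrArg (fun f => f ⟨v, hv⟩) h0
    have := hP v u hu
    rwa [hPv, Submodule.coe_zero, map_zero, sub_zero] at this

/-- The isotypic components of a unitary representation are orthogonal. -/
theorem inner_eq_zero_of_isotypicComponent {G E : Type*} [Group G] [NormedAddCommGroup E]
    [InnerProductSpace ℂ E] [FiniteDimensional ℂ E] (ρ : Representation ℂ G E)
    (hρ : ∀ g u v, inner ℂ (ρ g u) (ρ g v) = inner ℂ u v)
    (S S' : Type*) [AddCommGroup S] [Module (MonoidAlgebra ℂ G) S] [AddCommGroup S']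
    [Module (MonoidAlgebra ℂ G) S'] [IsSimpleModule (MonoidAlgebra ℂ G) S]
    [IsSimpleModule (MonoidAlgebra ℂ G) S'] (h : IsEmpty (S' ≃ₗ[MonoidAlgebra ℂ G] S))
    {v u : ρ.asModule} (hv : v ∈ isotypicComponent (MonoidAlgebra ℂ G) ρ.asModule S')
    (hu : u ∈ isotypicComponent (MonoidAlgebra ℂ G) ρ.asModule S) :
    inner ℂ (ρ.asModuleEquiv v) (ρ.asModuleEquiv u) = 0 := by
  rw [isotypicComponent, sSup_eq_iSup'] at hv hu
  induction hv using Submodule.iSup_induction' with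
  | zero => simp
  | add x y _ _ hx hy => rw [map_add, inner_add_left, hx, hy, add_zero]
  | mem N' x hx =>
    induction hu using Submodule.iSup_induction' with
    | zero => simp
    | add y z _ _ hy hz => rw [map_add, inner_add_right, hy, hz, add_zero]
    | mem N y hy =>
      obtain ⟨N, ⟨e⟩⟩ := N
      obtain ⟨N', ⟨e'⟩⟩ := N'
      have := IsSimpleModule.congr e
      have := IsSimpleModule.congr e'
      exact inner_eq_zero_of_simple ρ hρ N N' ⟨fun q => h.false (e'.symm.trans (q.trans e))⟩ hx hy

/-- A central element acts on an isotypic component by a scalar. -/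
theorem exists_smul_eq_of_mem_isotypicComponent {A M S : Type*} [Ring A] [Algebra ℂ A]
    [AddCommGroup M] [Module ℂ M] [Module A M] [IsScalarTower ℂ A M]
    [AddCommGroup S] [Module ℂ S] [Module A S] [IsScalarTower ℂ A S] [FiniteDimensional ℂ S]
    [IsSimpleModule A S] (z : A) (hz : ∀ a, z * a = a * z) :
    ∃ c : ℂ, ∀ v ∈ isotypicComponent A M S, z • v = c • v := by
  let Z : Module.End A S :=
    { toFun := fun v => z • v
      map_add' := smul_add z
      map_smul' := fun a v => by rw [RingHom.id_apply, ← mul_smul, hz, mul_smul] }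
  obtain ⟨c, hc⟩ := (IsSimpleModule.algebraMap_end_bijective_of_isAlgClosed (A := A) (V := S) ℂ).2 Z
  refine ⟨c, fun v hv => ?_⟩
  rw [isotypicComponent, sSup_eq_iSup'] at hv
  induction hv using Submodule.iSup_induction' with
  | zero => simp
  | add x y _ _ hx hy => rw [smul_add, smul_add, hx, hy]
  | mem N x hx =>
    obtain ⟨N, ⟨e⟩⟩ := N
    have h1 : z • e ⟨x, hx⟩ = c • e ⟨x, hx⟩ := by
      have := congrArg (fun f => f (e ⟨x, hx⟩)) hc
      simpa [Z, Module.algebraMap_end_apply] using this.symm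
    rw [← algebraMap_smul A c, ← map_smul, ← map_smul] at h1
    have h2 := congrArg Subtype.val (e.injective h1)
    simpa using h2

theorem inner_rep {n k : ℕ} (σ : Equiv.Perm (Fin n)) (u v : F n k) :
    inner ℂ (rep n k σ u) (rep n k σ v) = inner ℂ u v := by
  simp only [PiLp.inner_apply]
  let e : X n k ≃ X n k :=
    { toFun := permInv σ
      invFun := permInv σ⁻¹
      left_inv := fun x => Subtype.ext (funext fun j => by simp [permInv])
      right_inv := fun x => Subtype.ext (funext fun j => by simp [permInv]) }
  exact e.sum_comp fun x => inner ℂ (u x) (v x)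

/-- Distinct isotypic components of the function space are orthogonal. -/
theorem eq_of_inner_ne_zero {n k i : ℕ} {μ ν : Irr (symSub n i)} {u v : F n k}
    (hu : u ∈ isotypic n k i μ) (hv : v ∈ isotypic n k i ν) (h : inner ℂ u v ≠ 0) : μ = ν := by
  induction μ using Quotient.inductionOn with | _ V
  induction ν using Quotient.inductionOn with | _ W
  obtain ⟨u, hu, rfl⟩ := hu
  obtain ⟨v, hv, rfl⟩ := hv
  by_contra hne
  have := V.2
  have := W.2
  refine h (inner_eq_zero_of_isotypicComponent (repSub n k i) (fun g => inner_rep g.1) W.1 V.1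
    ⟨fun e => hne (Quotient.sound ⟨e⟩)⟩ hu hv)

/-! ### The central sum of transpositions -/

theorem swap_mem_symSub {n j : ℕ} (a b : {a : Fin n // (a : ℕ) < j}) :
    Equiv.swap a.1 b.1 ∈ symSub n j := by
  rw [symSub, mem_fixingSubgroup_iff]
  intro p hp
  have hp' : j ≤ (p : ℕ) := hp
  have ha := a.2
  have hb := b.2
  exact Equiv.swap_apply_of_ne_of_ne (by rintro rfl; omega) (by rintro rfl; omega)

theorem symSub_apply_lt_iff {n j : ℕ} (g : symSub n j) (a : Fin n) :
    ((g.1 a : Fin n) : ℕ) < j ↔ (a : ℕ) < j := by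
  have hg : ∀ h : symSub n j, ∀ p : Fin n, j ≤ (p : ℕ) → h.1 p = p := fun h p hp =>
    (mem_fixingSubgroup_iff _).1 h.2 p hp
  constructor
  · intro h
    by_contra hn
    rw [hg g a (by omega)] at h
    exact hn h
  · intro h
    by_contra hn
    have := hg g (g.1 a) (by omega)
    rw [g.1.injective this] at hn
    exact hn h

/-- The sum of the transpositions `(a b)` in the group algebra of `S_j`, over all ordered pairs
(with `(a a) = 1`). -/
def swapElement (n j : ℕ) : MonoidAlgebra ℂ (symSub n j) :=
  ∑ a : {a : Fin n // (a : ℕ) < j}, ∑ b : {a : Fin n // (a : ℕ) < j},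
    MonoidAlgebra.of ℂ _ ⟨Equiv.swap a.1 b.1, swap_mem_symSub a b⟩

/-- Conjugation by `g` sends `(a b)` to `(g a g b)`, and `g` permutes the first `j` places, so it
only reindexes the sum. -/
theorem swapElement_central (n j : ℕ) (r : MonoidAlgebra ℂ (symSub n j)) :
    swapElement n j * r = r * swapElement n j := by
  induction r using MonoidAlgebra.induction_on with
  | of g =>
    unfold swapElement
    simp_rw [Finset.sum_mul, Finset.mul_sum, ← map_mul]
    rw [← Equiv.sum_comp (g.1.subtypePerm (symSub_apply_lt_iff g))]
    refine Finset.sum_congr rfl fun a _ => ?_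
    rw [← Equiv.sum_comp (g.1.subtypePerm (symSub_apply_lt_iff g))]
    refine Finset.sum_congr rfl fun b _ => congrArg _ (Subtype.ext ?_)
    exact (Equiv.mul_swap_eq_swap_mul g.1 a.1 b.1).symm
  | add r s hr hs => rw [mul_add, add_mul, hr, hs]
  | smul c r hr => rw [mul_smul_comm, smul_mul_assoc, hr]

/-- The extension by zero of a function on `X` to all words. -/
def extendZero {n k : ℕ} (f : F n k) (x : Fin n → Letter) : ℂ :=
  if h : (Finset.univ.filter fun j => x j = Letter.one).card = k then f ⟨x, h⟩ else 0

theorem extendZero_val {n k : ℕ} (f : F n k) (x : X n k) : extendZero f x.1 = f x :=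
  dif_pos x.2

theorem card_comp_perm {n : ℕ} (x : Fin n → Letter) (σ : Equiv.Perm (Fin n)) :
    (Finset.univ.filter fun j => (x ∘ σ) j = Letter.one).card =
      (Finset.univ.filter fun j => x j = Letter.one).card :=
  Finset.card_equiv σ (by simp)

/-- Links the group algebra to functions on all words. These are needed because changing a letter
leaves `X`. -/
theorem swapSum_extendZero {n k j : ℕ} (f : F n k) (x : Fin n → Letter) :
    swapSum j (extendZero f) x =
      extendZero ((repSub n k j).asAlgebraHom (swapElement n j) f) x := by
  by_cases hx : (Finset.univ.filter fun j => x j = Letter.one).card = k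
  · have h1 : ∀ σ : Equiv.Perm (Fin n), extendZero f (x ∘ σ) = f (permInv σ ⟨x, hx⟩) := by
      intro σ
      exact extendZero_val f (permInv σ ⟨x, hx⟩)
    rw [show x = (⟨x, hx⟩ : X n k).1 from rfl, extendZero_val]
    unfold swapSum swapElement
    simp_rw [map_sum, Representation.asAlgebraHom_of, LinearMap.sum_apply]
    rw [← Finset.sum_subtype_eq_sum_filter]
    simp only [Finset.subtype_univ, WithLp.ofLp_sum, Finset.sum_apply]
    refine Finset.sum_congr rfl fun a _ => ?_
    rw [← Finset.sum_subtype_eq_sum_filter]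
    simp only [Finset.subtype_univ]
    exact Finset.sum_congr rfl fun b _ => h1 _
  · have h1 : ∀ σ : Equiv.Perm (Fin n), extendZero f (x ∘ σ) = 0 := by
      intro σ
      exact dif_neg (by rwa [card_comp_perm])
    unfold swapSum
    simp only [h1, Finset.sum_const_zero]
    rw [extendZero, dif_neg hx]

theorem exists_eigenvalue {n k j : ℕ} (lam : Irr (symSub n j)) :
    ∃ c : ℂ, ∀ f ∈ isotypic n k j lam, ∀ x,
      swapSum j (extendZero f) x = c * extendZero f x := by
  induction lam using Quotient.inductionOn with | _ V
  have := V.2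
  have : FiniteDimensional ℂ (MonoidAlgebra ℂ (symSub n j)) :=
    .of_basis (MonoidAlgebra.basis (symSub n j) ℂ)
  have : FiniteDimensional ℂ V.1 :=
    inferInstanceAs (FiniteDimensional ℂ (V.1.restrictScalars ℂ))
  obtain ⟨c, hc⟩ := exists_smul_eq_of_mem_isotypicComponent (M := (repSub n k j).asModule)
    (S := V.1) (swapElement n j) (swapElement_central n j)
  refine ⟨c, ?_⟩
  rintro _ ⟨f, hf, rfl⟩ x
  have h := congrArg (repSub n k j).asModuleEquiv (hc f hf)
  rw [Representation.asModuleEquiv_map_smul, map_smul] at h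
  rw [swapSum_extendZero]
  erw [h]
  unfold extendZero
  split_ifs
  · rfl
  · simp

/-! ### Gelfand–Tsetlin subspaces and labels -/

theorem eq_of_mem_wordSpace {n k i : ℕ} {w : Word n k i} {f : F n k} (hf : f ∈ wordSpace w)
    {x : X n k} (hx : f x ≠ 0) (j : {j : Fin n // i ≤ (j : ℕ)}) : x.1 j.1 = w.1 j := by
  revert hx
  refine Submodule.span_induction (p := fun f _ => f x ≠ 0 → x.1 j.1 = w.1 j) ?_ ?_ ?_ ?_ hf
  · rintro _ ⟨y, hy, rfl⟩ hx
    have : x = y := by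
      by_contra hne
      exact hx (by simp [hne])
    rw [this, hy]
  · intro h
    simp at h
  · intro f g _ _ hf hg h
    by_cases h1 : f x = 0
    · refine hg fun h2 => h ?_
      simp [h1, h2]
    · exact hf h1
  · intro c f _ hf h
    refine hf fun h1 => h ?_
    simp [h1]

/-- The Gelfand–Tsetlin subspaces are at most one-dimensional. -/
theorem eq_smul_of_mem_gtSpace {n k i : ℕ} (hi : i ≤ n) {w : Word n k i} {T : Chain n i}
    {f g : F n k} (hf : f ∈ gtSpace w T) (hg : g ∈ gtSpace w T) (hf0 : f ≠ 0) :
    ∃ t : ℂ, g = t • f := by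
  choose c hc using fun j : Fin i => exists_eigenvalue (k := k) (T.irr j)
  -- The index shifts by one since `T.irr j` is a representation of `S_{j+1}`; for `j = 0` the sum
  -- is empty and the eigenvalue 0. The letters of `w'` before place `i` are arbitrary.
  let c' : ℕ → ℂ := fun j => if h : j ≠ 0 ∧ j - 1 < i then c ⟨j - 1, h.2⟩ else 0
  let w' : Fin n → Letter := fun j => if h : i ≤ (j : ℕ) then w.1 ⟨j, h⟩ else Letter.one
  have key : ∀ {f : F n k}, f ∈ gtSpace w T → IsJointEigen k c' i w' (extendZero f) := by
    intro f hf
    refine ⟨fun x hx => ?_, fun x hx j hj => ?_, fun j hj x => ?_⟩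
    · by_contra hne
      refine hx (dif_neg fun h => hne ?_)
      simpa [letterCount] using h
    · have hk : (Finset.univ.filter fun j => x j = Letter.one).card = k :=
        by_contra fun h => hx (dif_neg h)
      rw [show x = (⟨x, hk⟩ : X n k).1 from rfl, extendZero_val] at hx
      simpa [w', hj] using eq_of_mem_wordSpace hf.2 hx ⟨j, hj⟩
    · rcases j with _ | j
      · simp [swapSum, c']
      · have h := hc ⟨j, hj⟩ f ((Submodule.mem_iInf _).1 hf.1 ⟨j, hj⟩) x
        have hj' : j < i := hj
        simpa [c', hj'] using h
  have h0 : extendZero f ≠ 0 := by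
    intro h
    refine hf0 (PiLp.ext fun x => ?_)
    rw [← extendZero_val, h]
    rfl
  obtain ⟨t, ht⟩ := (key hf).eq_smul hi (key hg) h0
  refine ⟨t, PiLp.ext fun x => ?_⟩
  rw [← extendZero_val, ht, PiLp.smul_apply, ← extendZero_val]
  rfl

/-- The labels of two functions that are not orthogonal agree where both are defined. -/
theorem label_eq_of_inner_ne_zero {n k i : ℕ} {b b' : F n k} (h : inner ℂ b' b ≠ 0)
    {w : Word n k (i + 1)} {T : Chain n (i + 1)} (hb : b ∈ gtSpace w T)
    {w' : Word n k i} {T' : Chain n i} (hb' : b' ∈ gtSpace w' T') :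
    T' = T.init ∧
      ∀ (j : Fin n) (hj : i + 1 ≤ (j : ℕ)), w'.1 ⟨j, Nat.le_of_succ_le hj⟩ = w.1 ⟨j, hj⟩ := by
  constructor
  · refine Chain.ext (funext fun j => ?_)
    exact eq_of_inner_ne_zero ((Submodule.mem_iInf _).1 hb'.1 j)
      ((Submodule.mem_iInf _).1 hb.1 j.castSucc) h
  · intro j hj
    rw [PiLp.inner_apply] at h
    obtain ⟨x, -, hx⟩ := Finset.exists_ne_zero_of_sum_ne_zero h
    have h1 : b' x ≠ 0 := fun h => hx (by simp [h])
    have h2 : b x ≠ 0 := fun h => hx (by simp [h])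
    rw [← eq_of_mem_wordSpace hb'.2 h1, ← eq_of_mem_wordSpace hb.2 h2]

end Johnson

end

/-! ### The theorem -/

theorem mainTheorem2 (n k i : ℕ) (hi : i + 1 ≤ n)
    (B B' : Set (Johnson.F n k))
    (hB : Johnson.IsIntermediateBasis n k (i + 1) B)
    (hB' : Johnson.IsIntermediateBasis n k i B')
    (b : Johnson.F n k) (hb : b ∈ B) :
    -- at most two elements of `B'` are not orthogonal to `b`
    {b' ∈ B' | inner ℂ b' b ≠ 0}.encard ≤ 2 ∧
    -- their labels agree with the label of `b`, the letter at the place `i + 1` excepted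
    (∀ (w : Johnson.Word n k (i + 1)) (T : Johnson.Chain n (i + 1)),
      b ∈ Johnson.gtSpace w T →
      ∀ b' ∈ B', inner ℂ b' b ≠ 0 →
      ∀ (w' : Johnson.Word n k i) (T' : Johnson.Chain n i),
        b' ∈ Johnson.gtSpace w' T' →
        T' = T.init ∧
        ∀ (j : Fin n) (hj : i + 1 ≤ (j : ℕ)), w'.1 ⟨j, Nat.le_of_succ_le hj⟩ = w.1 ⟨j, hj⟩) ∧
    -- and they are determined by their letter at the place `i + 1`
    (∀ b₁ ∈ B', inner ℂ b₁ b ≠ 0 → ∀ b₂ ∈ B', inner ℂ b₂ b ≠ 0 →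
      ∀ (w₁ w₂ : Johnson.Word n k i) (T₁ T₂ : Johnson.Chain n i),
        b₁ ∈ Johnson.gtSpace w₁ T₁ → b₂ ∈ Johnson.gtSpace w₂ T₂ →
        w₁.1 ⟨⟨i, hi⟩, le_rfl⟩ = w₂.1 ⟨⟨i, hi⟩, le_rfl⟩ → b₁ = b₂) := by
  have huniq : ∀ b₁ ∈ B', inner ℂ b₁ b ≠ 0 → ∀ b₂ ∈ B', inner ℂ b₂ b ≠ 0 →
      ∀ (w₁ w₂ : Johnson.Word n k i) (T₁ T₂ : Johnson.Chain n i),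
        b₁ ∈ Johnson.gtSpace w₁ T₁ → b₂ ∈ Johnson.gtSpace w₂ T₂ →
        w₁.1 ⟨⟨i, hi⟩, le_rfl⟩ = w₂.1 ⟨⟨i, hi⟩, le_rfl⟩ → b₁ = b₂ := by
    intro b₁ hb₁ h₁ b₂ hb₂ h₂ w₁ w₂ T₁ T₂ hm₁ hm₂ hw
    obtain ⟨w, T, hbT⟩ := hB.mem_gtSpace b hb
    obtain ⟨rfl, hw₁⟩ := Johnson.label_eq_of_inner_ne_zero h₁ hbT hm₁
    obtain ⟨rfl, hw₂⟩ := Johnson.label_eq_of_inner_ne_zero h₂ hbT hm₂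
    have hww : w₁ = w₂ := by
      refine Subtype.ext (funext fun ⟨j, hj⟩ => ?_)
      rcases hj.eq_or_lt with h | h
      · have : j = ⟨i, hi⟩ := Fin.ext h.symm
        subst this
        exact hw
      · exact (hw₁ j h).trans (hw₂ j h).symm
    subst hww
    have hne : b₁ ≠ 0 := by
      rintro rfl
      simp at h₁
    obtain ⟨t, rfl⟩ := Johnson.eq_smul_of_mem_gtSpace (by omega) hm₁ hm₂ hne
    by_contra hdiff
    -- Two distinct elements of `B'` on one line would be orthogonal, hence one of them zero, but
    -- neither is orthogonal to `b`.
    have horth : inner ℂ b₁ (t • b₁) = 0 :=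
      hB'.orthonormal.2 (i := ⟨b₁, hb₁⟩) (j := ⟨t • b₁, hb₂⟩)
        fun h => hdiff (congrArg Subtype.val h)
    rw [inner_smul_right, mul_eq_zero, inner_self_eq_zero] at horth
    rcases horth with rfl | h
    · simp at h₂
    · exact hne h
  refine ⟨?_, fun w T hbT b' _ h w' T' hm => Johnson.label_eq_of_inner_ne_zero h hbT hm, huniq⟩
  have : Nonempty Johnson.Letter := ⟨Johnson.Letter.one⟩
  have hlabel : ∀ b' ∈ B', ∃ (l : Johnson.Letter) (w : Johnson.Word n k i) (T : Johnson.Chain n i),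
      b' ∈ Johnson.gtSpace w T ∧ w.1 ⟨⟨i, hi⟩, le_rfl⟩ = l := by
    intro b' hb'
    obtain ⟨w, T, h⟩ := hB'.mem_gtSpace b' hb'
    exact ⟨_, w, T, h, rfl⟩
  choose! l hl using hlabel
  -- The free letter injects the elements not orthogonal to `b` into a two-letter alphabet.
  have hinj : Set.InjOn l {b' ∈ B' | inner ℂ b' b ≠ 0} := by
    intro b₁ h₁ b₂ h₂ h
    obtain ⟨w₁, T₁, hm₁, e₁⟩ := hl b₁ h₁.1
    obtain ⟨w₂, T₂, hm₂, e₂⟩ := hl b₂ h₂.1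
    exact huniq b₁ h₁.1 h₁.2 b₂ h₂.1 h₂.2 _ _ _ _ hm₁ hm₂ (e₁.trans (h.trans e₂.symm))
  rw [← hinj.encard_image]
  refine (Set.encard_le_encard (Set.subset_univ _)).trans ?_
  rw [Set.encard_univ, ENat.card_eq_coe_fintype_card]
  exact_mod_cast (show Fintype.card Johnson.Letter ≤ 2 by decide)
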